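/- Let $q$ be a power of a prime $p$. There is a constant $C=C_q>0$, depending only on $q$, such that the following holds for every $n\ge 0$ and every real $K$. If $A,S\subset\mathbb{F}_q^n$ are non-empty sets with $|A+S|\le K\min\{|A|,|S|\}$, then $(A-A)+(S-S)$ contains an $\mathbb{F}_p$-linear subspace $V$ of $\mathbb{F}_q^n$ (so an $\mathbb{F}_q$-linear subspace when $q$ is prime) such that $$\bigl|\log_p|A+S|-\dim_{\mathbb{F}_p}V\bigr|\le C\log^4K\qquad\text{and}\qquad |V|\ge\exp(-C\log^4K)\,|A+S|.$$ Here $A+S=\{a+s: a\in A,\ s\in S\}$, and $A-A$, $S-S$ and $(A-A)+(S-S)$ are defined similarly. -/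

import Mathlib

open scoped Pointwise

open Finset Real

/-! Only the F_p-structure matters, so work over `ZMod p` with B = A + S, noting (A - A) + (S - S) =
B - B.

Dense case: let A, S have density at least α in G, put L = log(1/α), and let F(y) be the proportion
of pairs (a, s) with y + a + s in B, so F(0) = 1. By Croot–Sisask sampling
(`exists_almost_periods`), F moves little under shifts by X - X for some X of density at least α^k /
2. Averaging m times over X - X therefore changes F little, and damps every Fourier coefficient
outside the large spectrum of X by 4^(-m). Hence F stays positive on the annihilator V of that
spectrum, and positivity at v puts v in B - B. Chang's bound makes the codimension of V at most of
order k L; taking m of order L and k of order L m^2 gives L^4.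

General case: Plünnecke–Ruzsa bounds 3B - 3B, so a quotient by a maximal subspace avoiding its
non-zero elements has size comparable to |B|. The images of A and S are dense there, and the
subspace found lifts back into B - B (`exists_submodule_lift`).

When K < 3/2, log K may be arbitrarily small and no loss is allowed; there A + S is exactly a coset
of a subgroup (`exists_addSubgroup_of_card_add_lt`). When K ≥ 3/2, log K is bounded below and
constants are absorbed into log^4 K. -/

/-! ### Concentration of sample sums. -/

/-- Exponential moment bound for a centred bounded function. -/
theorem sum_exp_mul_le {ι : Type*} (s : Finset ι) (g : ι → ℝ) (hg : ∀ i ∈ s, |g i| ≤ 1)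
    (hsum : ∑ i ∈ s, g i = 0) {l : ℝ} (hl : |l| ≤ 1) :
    ∑ i ∈ s, exp (l * g i) ≤ #s * exp (l ^ 2) := by
  have key : ∀ i ∈ s, exp (l * g i) ≤ 1 + l * g i + l ^ 2 := by
    intro i hi
    have h1 : |l * g i| ≤ 1 := by
      rw [abs_mul]; exact mul_le_one₀ hl (abs_nonneg _) (hg i hi)
    have h2 := (abs_le.1 (abs_exp_sub_one_sub_id_le h1)).2
    have h3 : (l * g i) ^ 2 ≤ l ^ 2 := by
      rw [mul_pow]
      have : (g i) ^ 2 ≤ 1 := (sq_le_one_iff_abs_le_one _).2 (hg i hi)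
      nlinarith [sq_nonneg l]
    linarith
  calc ∑ i ∈ s, exp (l * g i) ≤ ∑ i ∈ s, (1 + l * g i + l ^ 2) := sum_le_sum key
    _ = #s * (l ^ 2 + 1) := by
      rw [sum_add_distrib, sum_add_distrib, ← mul_sum, hsum]; simp; ring
    _ ≤ _ := by gcongr; exact add_one_le_exp _

/-- One-sided Hoeffding inequality, in counting form. -/
theorem card_filter_le_sum_le {ι : Type*} [DecidableEq ι] (s : Finset ι) (g : ι → ℝ)
    (hg : ∀ i ∈ s, |g i| ≤ 1) (hsum : ∑ i ∈ s, g i = 0) (k : ℕ) {ε : ℝ} (hε : 0 ≤ ε)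
    (hε1 : ε ≤ 1) :
    (#{a ∈ Fintype.piFinset (fun _ : Fin k => s) | k * ε ≤ ∑ i, g (a i)} : ℝ) ≤
      (#s : ℝ) ^ k * exp (-(ε ^ 2 * k / 4)) := by
  -- This choice minimises l ^ 2 - l * ε, with minimum -ε ^ 2 / 4.
  set l := ε / 2 with hl
  have hl1 : |l| ≤ 1 := by rw [abs_of_nonneg (by positivity)]; linarith
  have h1 : ∑ a ∈ Fintype.piFinset (fun _ : Fin k => s), exp (l * ∑ i, g (a i)) =
      (∑ x ∈ s, exp (l * g x)) ^ k := by
    have := prod_univ_sum (fun _ : Fin k => s) (fun _ x => exp (l * g x))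
    simp only [prod_const, card_univ, Fintype.card_fin] at this
    rw [this]
    refine sum_congr rfl fun a _ => ?_
    rw [mul_sum, exp_sum]
  have h2 : (#{a ∈ Fintype.piFinset (fun _ : Fin k => s) | k * ε ≤ ∑ i, g (a i)} : ℝ) *
      exp (l * (k * ε)) ≤ (#s * exp (l ^ 2)) ^ k := by
    calc _ = ∑ a ∈ Fintype.piFinset (fun _ : Fin k => s) with k * ε ≤ ∑ i, g (a i),
          exp (l * (k * ε)) := by simp
      _ ≤ ∑ a ∈ Fintype.piFinset (fun _ : Fin k => s) with k * ε ≤ ∑ i, g (a i),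
          exp (l * ∑ i, g (a i)) := by
        refine sum_le_sum fun a ha => ?_
        have := (mem_filter.1 ha).2
        gcongr
      _ ≤ ∑ a ∈ Fintype.piFinset (fun _ : Fin k => s), exp (l * ∑ i, g (a i)) :=
        sum_le_sum_of_subset_of_nonneg (filter_subset _ _) fun _ _ _ => (exp_pos _).le
      _ = _ := h1
      _ ≤ _ := by
        gcongr
        exact sum_exp_mul_le s g hg hsum hl1
  rw [← le_div_iff₀ (exp_pos _)] at h2
  refine h2.trans (le_of_eq ?_)
  rw [mul_pow, ← exp_nat_mul, mul_div_assoc, ← exp_sub]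
  congr 2
  rw [hl]; ring

/-- Two-sided Hoeffding inequality, in counting form. -/
theorem card_filter_lt_abs_sum_le {ι : Type*} [DecidableEq ι] (s : Finset ι) (g : ι → ℝ)
    (hg : ∀ i ∈ s, |g i| ≤ 1) (hsum : ∑ i ∈ s, g i = 0) (k : ℕ) {ε : ℝ} (hε : 0 ≤ ε)
    (hε1 : ε ≤ 1) :
    (#{a ∈ Fintype.piFinset (fun _ : Fin k => s) | k * ε < |∑ i, g (a i)|} : ℝ) ≤
      2 * (#s : ℝ) ^ k * exp (-(ε ^ 2 * k / 4)) := by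
  have h1 := card_filter_le_sum_le s g hg hsum k hε hε1
  have h2 := card_filter_le_sum_le s (fun i => - g i) (by simpa using hg) (by simp [hsum]) k hε hε1
  have h3 : #{a ∈ Fintype.piFinset (fun _ : Fin k => s) | k * ε < |∑ i, g (a i)|} ≤
      #{a ∈ Fintype.piFinset (fun _ : Fin k => s) | k * ε ≤ ∑ i, g (a i)} +
      #{a ∈ Fintype.piFinset (fun _ : Fin k => s) | k * ε ≤ ∑ i, -g (a i)} := by
    refine (card_le_card ?_).trans (card_union_le _ _)
    intro a ha
    simp only [mem_filter, mem_union] at ha ⊢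
    rcases lt_abs.1 ha.2 with h | h
    · exact Or.inl ⟨ha.1, h.le⟩
    · exact Or.inr ⟨ha.1, by rw [sum_neg_distrib]; exact h.le⟩
  have h4 : (#{a ∈ Fintype.piFinset (fun _ : Fin k => s) | k * ε < |∑ i, g (a i)|} : ℝ) ≤
      #{a ∈ Fintype.piFinset (fun _ : Fin k => s) | k * ε ≤ ∑ i, g (a i)} +
      #{a ∈ Fintype.piFinset (fun _ : Fin k => s) | k * ε ≤ ∑ i, -g (a i)} := by exact_mod_cast h3
  linarith

/-! ### Croot–Sisask almost-periodicity. -/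

section AlmostPeriodicity

variable {G : Type*} [AddCommGroup G]

/-- The average of `f` over the translate `y + A`. -/
noncomputable def shiftAverage (A : Finset G) (f : G → ℝ) (y : G) : ℝ :=
  (∑ a ∈ A, f (y + a)) / #A

theorem abs_shiftAverage_sub_le {A : Finset G} (hA : A.Nonempty) (f g : G → ℝ) (y z : G) {c : ℝ}
    (h : ∀ a ∈ A, |f (y + a) - g (z + a)| ≤ c) :
    |shiftAverage A f y - shiftAverage A g z| ≤ c := by
  have hA' : (0 : ℝ) < #A := by exact_mod_cast hA.card_pos
  rw [shiftAverage, shiftAverage, ← sub_div, ← sum_sub_distrib, abs_div, abs_of_pos hA',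
    div_le_iff₀ hA']
  calc _ ≤ ∑ a ∈ A, |f (y + a) - g (z + a)| := abs_sum_le_sum_abs _ _
    _ ≤ ∑ a ∈ A, c := sum_le_sum h
    _ = _ := by simp; ring

theorem shiftAverage_comm (A S : Finset G) (f : G → ℝ) (y : G) :
    shiftAverage A (shiftAverage S f) y = shiftAverage S (shiftAverage A f) y := by
  simp only [shiftAverage, ← sum_div]
  rw [sum_comm, div_right_comm]
  refine congrArg (· / _) (congrArg (· / _) (sum_congr rfl fun s _ => sum_congr rfl fun a _ => ?_))
  rw [add_right_comm]

theorem shiftAverage_mem_Icc (A : Finset G) {f : G → ℝ} (hf : ∀ x, f x ∈ Set.Icc (0 : ℝ) 1)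
    (y : G) : shiftAverage A f y ∈ Set.Icc (0 : ℝ) 1 := by
  refine ⟨div_nonneg (sum_nonneg fun _ _ => (hf _).1) (by positivity), div_le_one_of_le₀ ?_ (by positivity)⟩
  calc _ ≤ ∑ a ∈ A, (1 : ℝ) := sum_le_sum fun _ _ => (hf _).2
    _ = _ := by simp

variable [Fintype G] [DecidableEq G]

/-- Most samples `a ∈ A ^ k` approximate the average over `A` uniformly, once smoothed by `S`. -/
theorem card_uniform_sample_ge {A S : Finset G} (hA : A.Nonempty) (hS : S.Nonempty) {f : G → ℝ}
    (hf : ∀ x, f x ∈ Set.Icc (0 : ℝ) 1) {k : ℕ} (hk : 0 < k) {ε : ℝ} (hε : 0 < ε) (hε1 : ε ≤ 1)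
    (h : 4 * Fintype.card G * exp (-(ε ^ 2 * k / 4)) ≤ ε * #S) :
    (#A : ℝ) ^ k ≤ 2 * #{a ∈ Fintype.piFinset (fun _ : Fin k => A) | ∀ y,
      |(∑ i, shiftAverage S f (y + a i)) / k - shiftAverage A (shiftAverage S f) y| ≤ 2 * ε} := by
  classical
  have hk' : (0 : ℝ) < k := by exact_mod_cast hk
  have hS' : (0 : ℝ) < #S := by exact_mod_cast hS.card_pos
  have hA' : (0 : ℝ) < #A := by exact_mod_cast hA.card_pos
  set P := Fintype.piFinset (fun _ : Fin k => A) with hP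
  have hPcard : (#P : ℝ) = (#A : ℝ) ^ k := by simp [hP]
  set e : (Fin k → G) → G → ℝ := fun a z => ∑ i, (f (z + a i) - shiftAverage A f z) with he
  have hcount : ∀ z, (#{a ∈ P | k * ε < |e a z|} : ℝ) ≤
      2 * (#A : ℝ) ^ k * exp (-(ε ^ 2 * k / 4)) := by
    intro z
    refine card_filter_lt_abs_sum_le A (fun x => f (z + x) - shiftAverage A f z) ?_ ?_ k hε.le hε1
    · intro x _
      have h1 := hf (z + x)
      have h2 := shiftAverage_mem_Icc A hf z
      exact abs_le.2 ⟨by linarith [h1.1, h2.2], by linarith [h1.2, h2.1]⟩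
    · rw [sum_sub_distrib, sum_const, nsmul_eq_mul, shiftAverage]
      field_simp; simp
  set bad : (Fin k → G) → Finset G := fun a => {z | k * ε < |e a z|} with hbad
  have htotal : ∑ a ∈ P, (#(bad a) : ℝ) ≤ (#A : ℝ) ^ k * (ε * #S / 2) := by
    have : ∑ a ∈ P, (#(bad a) : ℝ) = ∑ z : G, (#{a ∈ P | k * ε < |e a z|} : ℝ) := by
      simp only [hbad, card_filter, Nat.cast_sum]
      rw [sum_comm]
    rw [this]
    calc _ ≤ ∑ z : G, 2 * (#A : ℝ) ^ k * exp (-(ε ^ 2 * k / 4)) := sum_le_sum fun z _ => hcount z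
      _ = (#A : ℝ) ^ k * (4 * Fintype.card G * exp (-(ε ^ 2 * k / 4)) / 2) := by
        simp; ring
      _ ≤ _ := by gcongr
  -- Markov: a sample has at most ε |S| / 2 bad points on average, so at most half of the samples
  -- have more than ε |S|.
  set N : Finset (Fin k → G) := {a ∈ P | ε * #S < #(bad a)} with hN
  have hNcard : (#N : ℝ) ≤ (#A : ℝ) ^ k / 2 := by
    have h1 : (#N : ℝ) * (ε * #S) ≤ ∑ a ∈ P, (#(bad a) : ℝ) := by
      calc _ = ∑ a ∈ N, ε * (#S : ℝ) := by simp
        _ ≤ ∑ a ∈ N, (#(bad a) : ℝ) := sum_le_sum fun a ha => (mem_filter.1 ha).2.le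
        _ ≤ _ := sum_le_sum_of_subset_of_nonneg (filter_subset _ _) fun _ _ _ => by positivity
    have h2 : (#N : ℝ) * (ε * #S) ≤ (#A : ℝ) ^ k / 2 * (ε * #S) := by
      refine (h1.trans htotal).trans (le_of_eq (by ring))
    exact le_of_mul_le_mul_right h2 (by positivity)
  have hsub : P \ N ⊆ {a ∈ P | ∀ y,
      |(∑ i, shiftAverage S f (y + a i)) / k - shiftAverage A (shiftAverage S f) y| ≤ 2 * ε} := by
    intro a ha
    rw [mem_sdiff] at ha
    have haN : (#(bad a) : ℝ) ≤ ε * #S := by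
      by_contra hcon
      exact ha.2 (mem_filter.2 ⟨ha.1, not_le.1 hcon⟩)
    refine mem_filter.2 ⟨ha.1, fun y => ?_⟩
    have hid : (∑ i, shiftAverage S f (y + a i)) / k - shiftAverage A (shiftAverage S f) y =
        (∑ s ∈ S, e a (y + s) / k) / #S := by
      rw [shiftAverage_comm A S]
      have h1 : ∀ s, e a (y + s) / k = (∑ i, f (y + s + a i)) / k - shiftAverage A f (y + s) := by
        intro s
        simp only [he, sum_sub_distrib, sum_const, card_univ, Fintype.card_fin, nsmul_eq_mul]
        field_simp
      simp only [h1, sum_sub_distrib, sub_div]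
      congr 1
      simp only [shiftAverage, ← sum_div]
      rw [sum_comm, div_right_comm]
      simp only [add_right_comm]
    -- Smoothing by S turns "few bad points" into a bound at every y: of the points y + s at most ε
    -- |S| are bad, each costing at most 1, which adds a second ε.
    have hpt : ∀ s, |e a (y + s) / k| ≤ ε + (if y + s ∈ bad a then 1 else 0) := by
      intro s
      rw [abs_div, abs_of_pos hk']
      split_ifs with hb
      · have h1 : |e a (y + s)| ≤ k := by
          calc _ ≤ ∑ i : Fin k, |f (y + s + a i) - shiftAverage A f (y + s)| :=
                abs_sum_le_sum_abs _ _
            _ ≤ ∑ i : Fin k, (1 : ℝ) := by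
                refine sum_le_sum fun i _ => ?_
                have h1 := hf (y + s + a i)
                have h2 := shiftAverage_mem_Icc A hf (y + s)
                exact abs_le.2 ⟨by linarith [h1.1, h2.2], by linarith [h1.2, h2.1]⟩
            _ = k := by simp
        have := div_le_one_of_le₀ h1 hk'.le
        linarith
      · simp only [hbad, mem_filter, mem_univ, true_and, not_lt] at hb
        rw [add_zero, div_le_iff₀ hk']
        linarith
    rw [hid, abs_div, abs_of_pos hS', div_le_iff₀ hS']
    calc _ ≤ ∑ s ∈ S, |e a (y + s) / k| := abs_sum_le_sum_abs _ _
      _ ≤ ∑ s ∈ S, (ε + (if y + s ∈ bad a then 1 else 0)) := sum_le_sum fun s _ => hpt s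
      _ = ε * #S + #{s ∈ S | y + s ∈ bad a} := by
        rw [sum_add_distrib, sum_boole]; simp; ring
      _ ≤ ε * #S + #(bad a) := by
        refine add_le_add_right (Nat.cast_le.2 ?_) _
        refine card_le_card_of_injOn (fun s => y + s) ?_ ((add_right_injective y).injOn)
        intro s hs
        exact (mem_filter.1 (mem_coe.1 hs)).2
      _ ≤ _ := by linarith
  have h1 : (#P : ℝ) - #N ≤ #(P \ N) := by
    have := le_card_sdiff N P
    have h2 : #P ≤ #(P \ N) + #N := by omega
    have h3 : (#P : ℝ) ≤ #(P \ N) + #N := by exact_mod_cast h2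
    linarith
  have h2 : (#(P \ N) : ℝ) ≤ _ := Nat.cast_le.2 (card_le_card hsub)
  linarith

/-- Uniform almost-periodicity of a double average, over a large set of shifts. -/
theorem exists_almost_periods {A S : Finset G} (hA : A.Nonempty) (hS : S.Nonempty) {f : G → ℝ}
    (hf : ∀ x, f x ∈ Set.Icc (0 : ℝ) 1) {k : ℕ} (hk : 0 < k) {ε : ℝ} (hε : 0 < ε) (hε1 : ε ≤ 1)
    (h : 4 * Fintype.card G * exp (-(ε ^ 2 * k / 4)) ≤ ε * #S) :
    ∃ X : Finset G, (Fintype.card G : ℝ) * (#A : ℝ) ^ k ≤ 2 * #X * (Fintype.card G : ℝ) ^ k ∧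
      ∀ t ∈ X, ∀ t' ∈ X, ∀ y, |shiftAverage A (shiftAverage S f) (y + t - t') -
        shiftAverage A (shiftAverage S f) y| ≤ 4 * ε := by
  classical
  have hT := card_uniform_sample_ge hA hS hf hk hε hε1 h
  set T := {a ∈ Fintype.piFinset (fun _ : Fin k => A) | ∀ y,
      |(∑ i, shiftAverage S f (y + a i)) / k - shiftAverage A (shiftAverage S f) y| ≤ 2 * ε} with hTdef
  -- Pigeonhole over x: some x is a translate of a good sample for many t. Each such t makes the
  -- single sample x approximate F(· + t), so any two of these translates of F are close.
  set X : (Fin k → G) → Finset G := fun x => {t | (fun i => x i - t) ∈ T} with hX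
  have hsum : ∑ x : Fin k → G, #(X x) = Fintype.card G * #T := by
    simp only [hX, card_filter]
    rw [sum_comm]
    have : ∀ t : G, ∑ x : Fin k → G, (if (fun i => x i - t) ∈ T then 1 else 0) = #T := by
      intro t
      have := Equiv.sum_comp (Equiv.subRight (fun _ : Fin k => t))
        (fun x : Fin k → G => if x ∈ T then 1 else 0)
      refine Eq.trans this ?_
      simp
    simp [this]
  obtain ⟨x, -, hx⟩ : ∃ x ∈ (univ : Finset (Fin k → G)),
      (Fintype.card G * #T : ℝ) / (Fintype.card G : ℝ) ^ k ≤ #(X x) := by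
    apply exists_le_of_sum_le univ_nonempty
    rw [← Nat.cast_sum, hsum]
    simp only [sum_const, card_univ, Fintype.card_pi, prod_const, Fintype.card_fin, nsmul_eq_mul]
    push_cast
    rw [mul_div_cancel₀]
    have : (Fintype.card G : ℝ) ≠ 0 := by exact_mod_cast Fintype.card_ne_zero
    positivity
  refine ⟨X x, ?_, ?_⟩
  · have hG : (0 : ℝ) < Fintype.card G := by exact_mod_cast Fintype.card_pos
    rw [div_le_iff₀ (by positivity)] at hx
    nlinarith
  · have key : ∀ t ∈ X x, ∀ z, |(∑ i, shiftAverage S f (z + x i)) / k -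
        shiftAverage A (shiftAverage S f) (z + t)| ≤ 2 * ε := by
      intro t ht z
      simp only [hX, mem_filter, mem_univ, true_and, hTdef] at ht
      have := ht.2 (z + t)
      simpa [add_sub_assoc', add_assoc, add_comm, add_left_comm] using this
    intro t ht t' ht' y
    have h1 := abs_le.1 (key t ht (y - t'))
    have h2 := abs_le.1 (key t' ht' (y - t'))
    rw [sub_add_cancel] at h2
    rw [show y - t' + t = y + t - t' by abel] at h1
    exact abs_le.2 ⟨by linarith, by linarith⟩

end AlmostPeriodicity

/-! ### Fourier analysis on a finite vector space and its dual. -/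

section Fourier

variable {p : ℕ} [Fact p.Prime] {G : Type*} [AddCommGroup G] [Module (ZMod p) G]

/-- The Fourier coefficient at `ℓ` of the uniform measure on `A`. -/
noncomputable def uniformFourier (A : Finset G) (ℓ : Module.Dual (ZMod p) G) : ℂ :=
  (∑ a ∈ A, ZMod.stdAddChar (ℓ a)) / #A

theorem norm_stdAddChar (x : ZMod p) : ‖(ZMod.stdAddChar x : ℂ)‖ = 1 := by
  rw [ZMod.stdAddChar_apply]; exact Circle.norm_coe _

theorem conj_stdAddChar (x : ZMod p) :
    (starRingEnd ℂ) (ZMod.stdAddChar x) = ZMod.stdAddChar (-x) :=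
  (AddChar.map_neg_eq_conj _ _).symm

theorem norm_uniformFourier_neg [DecidableEq G] (A : Finset G) (ℓ : Module.Dual (ZMod p) G) :
    ‖uniformFourier (-A) ℓ‖ = ‖uniformFourier A ℓ‖ := by
  have : uniformFourier (-A) ℓ = (starRingEnd ℂ) (uniformFourier A ℓ) := by
    simp only [uniformFourier, map_div₀, map_sum, conj_stdAddChar, card_neg, map_natCast]
    rw [sum_neg_index]
    simp
  rw [this, RCLike.norm_conj]

variable [Fintype G]

/-- The (unnormalised) Fourier transform on the dual space. -/
noncomputable def dualFourier (f : G → ℝ) (ℓ : Module.Dual (ZMod p) G) : ℂ :=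
  ∑ x, (f x : ℂ) * ZMod.stdAddChar (-ℓ x)

/-- The opposite signs in `uniformFourier` and `dualFourier` suit the average of f (y + a), as
opposed to f (y - a), so no conjugate appears. -/
theorem dualFourier_shiftAverage (A : Finset G) (f : G → ℝ) (ℓ : Module.Dual (ZMod p) G) :
    dualFourier (shiftAverage A f) ℓ = uniformFourier A ℓ * dualFourier f ℓ := by
  have h : ∀ a ∈ A, ∑ x, (f (x + a) : ℂ) * ZMod.stdAddChar (-ℓ x) =
      ZMod.stdAddChar (ℓ a) * dualFourier f ℓ := by
    intro a _
    rw [dualFourier, ← Equiv.sum_comp (Equiv.addRight a)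
      (fun x => (f x : ℂ) * ZMod.stdAddChar (-ℓ x)), mul_sum]
    refine sum_congr rfl fun x _ => ?_
    simp only [Equiv.coe_addRight, map_add, neg_add, AddChar.map_add_eq_mul]
    have : (ZMod.stdAddChar (ℓ a) : ℂ) * ZMod.stdAddChar (-ℓ a) = 1 := by
      rw [← AddChar.map_add_eq_mul]; simp
    linear_combination (-(f (x + a) : ℂ) * ZMod.stdAddChar (-ℓ x)) * this
  calc _ = (∑ a ∈ A, ∑ x, (f (x + a) : ℂ) * ZMod.stdAddChar (-ℓ x)) / #A := by
        rw [sum_comm, dualFourier, sum_div]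
        refine sum_congr rfl fun x _ => ?_
        rw [shiftAverage, ← sum_mul]; push_cast; ring
    _ = _ := by rw [sum_congr rfl h, ← sum_mul, uniformFourier]; ring

theorem norm_dualFourier_le {f : G → ℝ} (hf : ∀ x, f x ∈ Set.Icc (0 : ℝ) 1)
    (ℓ : Module.Dual (ZMod p) G) : ‖dualFourier f ℓ‖ ≤ Fintype.card G := by
  refine (norm_sum_le _ _).trans ?_
  calc _ ≤ ∑ x : G, (1 : ℝ) := by
        refine sum_le_sum fun x _ => ?_
        rw [norm_mul, norm_stdAddChar, mul_one, Complex.norm_real, Real.norm_eq_abs,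
          abs_of_nonneg (hf x).1]
        exact (hf x).2
    _ = _ := by simp

variable [Fintype (Module.Dual (ZMod p) G)]

theorem card_dual_eq : Fintype.card (Module.Dual (ZMod p) G) = Fintype.card G := by
  rw [Module.card_eq_pow_finrank (K := ZMod p) (V := G),
    Module.card_eq_pow_finrank (K := ZMod p) (V := Module.Dual (ZMod p) G),
    Subspace.dual_finrank_eq]

/-- Functionals separate points, so evaluation at a non-zero z gives a non-trivial character of the
dual, whose sum vanishes. -/
theorem sum_dual_stdAddChar [DecidableEq G] (z : G) :
    ∑ ℓ : Module.Dual (ZMod p) G, (ZMod.stdAddChar (ℓ z) : ℂ) =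
      if z = 0 then (Fintype.card G : ℂ) else 0 := by
  split_ifs with hz
  · simp [hz, card_dual_eq]
  · let χ : AddChar (Module.Dual (ZMod p) G) ℂ :=
      (ZMod.stdAddChar : AddChar (ZMod p) ℂ).compAddMonoidHom
        (Module.Dual.eval (ZMod p) G z).toAddMonoidHom
    have hχ : χ ≠ 1 := by
      intro h
      apply hz
      rw [← Module.forall_dual_apply_eq_zero_iff (ZMod p) z]
      intro ℓ
      have h1 : χ ℓ = 1 := by rw [h]; rfl
      have h2 : (ZMod.stdAddChar (ℓ z) : ℂ) = ZMod.stdAddChar (0 : ZMod p) := by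
        rw [AddChar.map_zero_eq_one]; exact h1
      exact ZMod.injective_stdAddChar h2
    have := AddChar.sum_eq_zero_iff_ne_zero.2 hχ
    exact this

theorem dualFourier_inversion (f : G → ℝ) (y : G) :
    (∑ ℓ : Module.Dual (ZMod p) G, dualFourier f ℓ * ZMod.stdAddChar (ℓ y)) =
      Fintype.card G * f y := by
  classical
  simp only [dualFourier, sum_mul]
  rw [sum_comm]
  have : ∀ x, ∑ ℓ : Module.Dual (ZMod p) G,
      (f x : ℂ) * ZMod.stdAddChar (-ℓ x) * ZMod.stdAddChar (ℓ y) =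
      if y - x = 0 then (Fintype.card G : ℂ) * f x else 0 := by
    intro x
    have h := sum_dual_stdAddChar (p := p) (y - x)
    simp only [mul_assoc, ← mul_sum, ← AddChar.map_add_eq_mul]
    have h2 : ∀ ℓ : Module.Dual (ZMod p) G, -ℓ x + ℓ y = ℓ (y - x) := by
      intro ℓ; rw [map_sub]; ring
    simp only [h2, h]
    split_ifs <;> ring
  simp only [this, sub_eq_zero]
  simp

theorem sum_norm_uniformFourier_sq {A : Finset G} (hA : A.Nonempty) :
    ∑ ℓ : Module.Dual (ZMod p) G, ‖uniformFourier A ℓ‖ ^ 2 = Fintype.card G / #A := by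
  classical
  have hA' : (#A : ℂ) ≠ 0 := by exact_mod_cast hA.card_pos.ne'
  have h : ∀ ℓ : Module.Dual (ZMod p) G, ((‖uniformFourier A ℓ‖ ^ 2 : ℝ) : ℂ) =
      (∑ a ∈ A, ∑ b ∈ A, ZMod.stdAddChar (ℓ (a - b))) / (#A * #A) := by
    intro ℓ
    push_cast
    rw [← Complex.mul_conj', uniformFourier, map_div₀, map_sum, map_natCast, div_mul_div_comm,
      sum_mul_sum]
    congr 1
    refine sum_congr rfl fun a _ => sum_congr rfl fun b _ => ?_
    rw [conj_stdAddChar, ← AddChar.map_add_eq_mul, map_sub, sub_eq_add_neg]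
  have h2 : ((∑ ℓ : Module.Dual (ZMod p) G, ‖uniformFourier A ℓ‖ ^ 2 : ℝ) : ℂ) =
      ((Fintype.card G / #A : ℝ) : ℂ) := by
    rw [Complex.ofReal_sum]
    simp only [h, ← sum_div]
    rw [sum_comm]
    have : ∀ a ∈ A, ∑ ℓ : Module.Dual (ZMod p) G, ∑ b ∈ A, (ZMod.stdAddChar (ℓ (a - b)) : ℂ) =
        Fintype.card G := by
      intro a ha
      rw [sum_comm]
      simp only [sum_dual_stdAddChar, sub_eq_zero]
      simp [ha]
    rw [sum_congr rfl this]
    push_cast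
    rw [sum_const, nsmul_eq_mul]
    field_simp
  exact_mod_cast h2

/-- Parseval for each set, combined by AM-GM. Two averages are taken precisely so that this absolute
sum is bounded independently of |G|. -/
theorem sum_norm_uniformFourier_mul_le {A S : Finset G} (hA : A.Nonempty) (hS : S.Nonempty) {α : ℝ}
    (hα : 0 < α) (hAα : α * Fintype.card G ≤ #A) (hSα : α * Fintype.card G ≤ #S) :
    ∑ ℓ : Module.Dual (ZMod p) G, ‖uniformFourier A ℓ‖ * ‖uniformFourier S ℓ‖ ≤ 1 / α := by
  have key : ∀ {B : Finset G}, B.Nonempty → α * Fintype.card G ≤ #B →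
      ∑ ℓ : Module.Dual (ZMod p) G, ‖uniformFourier B ℓ‖ ^ 2 ≤ 1 / α := by
    intro B hB h
    have hB' : (0 : ℝ) < #B := by exact_mod_cast hB.card_pos
    rw [sum_norm_uniformFourier_sq hB, div_le_div_iff₀ hB' hα]
    linarith
  calc _ ≤ ∑ ℓ : Module.Dual (ZMod p) G,
        (‖uniformFourier A ℓ‖ ^ 2 + ‖uniformFourier S ℓ‖ ^ 2) / 2 := by
        refine sum_le_sum fun ℓ _ => ?_
        nlinarith [sq_nonneg (‖uniformFourier A ℓ‖ - ‖uniformFourier S ℓ‖)]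
    _ ≤ _ := by
        rw [← sum_div, sum_add_distrib]
        linarith [key hA hAα, key hS hSα]

end Fourier

/-! ### Iterated averaging over X - X. -/

section Iterates

variable {G : Type*} [AddCommGroup G] [DecidableEq G]

/-- Averaging over `X - X`. -/
noncomputable def diffAverage (X : Finset G) (f : G → ℝ) : G → ℝ :=
  shiftAverage X (shiftAverage (-X) f)

theorem abs_diffAverage_sub_le {X : Finset G} (hX : X.Nonempty) {f : G → ℝ} {c : ℝ}
    (h : ∀ t ∈ X, ∀ t' ∈ X, ∀ y, |f (y + t - t') - f y| ≤ c) (y : G) :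
    |diffAverage X f y - f y| ≤ c := by
  have hconst : ∀ (B : Finset G), B.Nonempty → ∀ z, shiftAverage B (fun _ => f y) z = f y := by
    intro B hB z
    have hB' : (#B : ℝ) ≠ 0 := by exact_mod_cast hB.card_pos.ne'
    simp [shiftAverage, hB']
  have hX' : (-X).Nonempty := hX.neg
  calc _ = |diffAverage X f y - shiftAverage X (shiftAverage (-X) fun _ => f y) y| := by
        congr 2
        rw [funext (hconst (-X) hX'), hconst X hX]
    _ ≤ c := by
        refine abs_shiftAverage_sub_le hX _ _ _ _ fun t ht => ?_
        refine abs_shiftAverage_sub_le hX' _ _ _ _ fun t' ht' => ?_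
        have := h t ht (-t') (by simpa using ht') y
        simpa using this

/-- Averaging is a contraction in the sup norm, so each iteration adds at most c. -/
theorem abs_diffAverage_iterate_sub_le {X : Finset G} (hX : X.Nonempty) {f : G → ℝ} {c : ℝ}
    (h : ∀ t ∈ X, ∀ t' ∈ X, ∀ y, |f (y + t - t') - f y| ≤ c) (m : ℕ) (y : G) :
    |(diffAverage X)^[m] f y - f y| ≤ m * c := by
  induction m generalizing y with
  | zero => simp
  | succ m ih =>
    rw [Function.iterate_succ_apply']
    have h1 : |diffAverage X ((diffAverage X)^[m] f) y - diffAverage X f y| ≤ m * c :=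
      abs_shiftAverage_sub_le hX _ _ _ _ fun _ _ =>
        abs_shiftAverage_sub_le hX.neg _ _ _ _ fun _ _ => ih _
    have h2 := abs_diffAverage_sub_le hX h y
    push_cast
    have := abs_sub_le (diffAverage X ((diffAverage X)^[m] f) y) (diffAverage X f y) (f y)
    linarith

variable {p : ℕ} [Fact p.Prime] [Module (ZMod p) G] [Fintype G]

theorem norm_dualFourier_diffAverage_iterate (X : Finset G) (f : G → ℝ) (m : ℕ)
    (ℓ : Module.Dual (ZMod p) G) :
    ‖dualFourier ((diffAverage X)^[m] f) ℓ‖ = ‖uniformFourier X ℓ‖ ^ (2 * m) * ‖dualFourier f ℓ‖ := by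
  induction m with
  | zero => simp
  | succ m ih =>
    rw [Function.iterate_succ_apply', diffAverage, dualFourier_shiftAverage,
      dualFourier_shiftAverage, norm_mul, norm_mul, norm_uniformFourier_neg, ih]
    ring

/-- The iterated averages are nearly invariant under vectors killed by the large spectrum. -/
theorem abs_diffAverage_iterate_sub_zero_le [Fintype (Module.Dual (ZMod p) G)] {A S X : Finset G}
    (hA : A.Nonempty) (hS : S.Nonempty) {α : ℝ}
    (hα : 0 < α) (hAα : α * Fintype.card G ≤ #A) (hSα : α * Fintype.card G ≤ #S)
    {f : G → ℝ} (hf : ∀ x, f x ∈ Set.Icc (0 : ℝ) 1) (m : ℕ) {v : G}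
    (hv : ∀ ℓ : Module.Dual (ZMod p) G, 1 / 2 < ‖uniformFourier X ℓ‖ → ℓ v = 0) :
    |(diffAverage X)^[m] (shiftAverage A (shiftAverage S f)) v -
      (diffAverage X)^[m] (shiftAverage A (shiftAverage S f)) 0| ≤ 2 * (1 / 4) ^ m * (1 / α) := by
  set F := shiftAverage A (shiftAverage S f) with hF
  set H := (diffAverage X)^[m] F with hH
  have hG : (0 : ℝ) < Fintype.card G := by exact_mod_cast Fintype.card_pos
  have h1 : (Fintype.card G : ℂ) * ((H v - H 0 : ℝ) : ℂ) =
      ∑ ℓ : Module.Dual (ZMod p) G, dualFourier H ℓ * (ZMod.stdAddChar (ℓ v) - 1) := by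
    push_cast
    rw [mul_sub, ← dualFourier_inversion (p := p) H v, ← dualFourier_inversion (p := p) H 0,
      ← sum_sub_distrib]
    refine sum_congr rfl fun ℓ _ => ?_
    simp; ring
  have h2 : ∀ ℓ : Module.Dual (ZMod p) G, ‖dualFourier H ℓ * (ZMod.stdAddChar (ℓ v) - 1)‖ ≤
      2 * (1 / 4) ^ m * Fintype.card G * (‖uniformFourier A ℓ‖ * ‖uniformFourier S ℓ‖) := by
    intro ℓ
    by_cases hℓ : 1 / 2 < ‖uniformFourier X ℓ‖
    · simp only [hv ℓ hℓ, AddChar.map_zero_eq_one, sub_self, mul_zero, norm_zero]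
      positivity
    · have h3 : ‖(ZMod.stdAddChar (ℓ v) : ℂ) - 1‖ ≤ 2 := by
        refine (norm_sub_le _ _).trans ?_
        rw [norm_stdAddChar, norm_one]; norm_num
      have h4 : ‖uniformFourier X ℓ‖ ^ (2 * m) ≤ (1 / 4) ^ m := by
        rw [pow_mul]
        refine pow_le_pow_left₀ (by positivity) ?_ _
        have := not_lt.1 hℓ
        nlinarith [norm_nonneg (uniformFourier X ℓ)]
      rw [norm_mul, hH, norm_dualFourier_diffAverage_iterate, hF, dualFourier_shiftAverage,
        dualFourier_shiftAverage, norm_mul, norm_mul]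
      have h5 := norm_dualFourier_le hf ℓ
      calc _ ≤ (1 / 4) ^ m * (‖uniformFourier A ℓ‖ * (‖uniformFourier S ℓ‖ * Fintype.card G)) * 2 := by
            gcongr
        _ = _ := by ring
  have h3 : (Fintype.card G : ℝ) * |H v - H 0| ≤
      Fintype.card G * (2 * (1 / 4) ^ m * (1 / α)) := by
    calc _ = ‖(Fintype.card G : ℂ) * ((H v - H 0 : ℝ) : ℂ)‖ := by
          rw [norm_mul, Complex.norm_real, Real.norm_eq_abs, Complex.norm_natCast]
      _ ≤ ∑ ℓ : Module.Dual (ZMod p) G, 2 * (1 / 4) ^ m * Fintype.card G *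
          (‖uniformFourier A ℓ‖ * ‖uniformFourier S ℓ‖) := by
          rw [h1]
          exact (norm_sum_le _ _).trans (sum_le_sum fun ℓ _ => h2 ℓ)
      _ ≤ 2 * (1 / 4) ^ m * Fintype.card G * (1 / α) := by
          rw [← mul_sum]
          gcongr
          exact sum_norm_uniformFourier_mul_le hA hS hα hAα hSα
      _ = _ := by ring
  exact le_of_mul_le_mul_left h3 hG

end Iterates

/-! ### Chang's bound on the large spectrum. -/

section Chang

variable {p : ℕ} [Fact p.Prime] {G : Type*} [AddCommGroup G] [Module (ZMod p) G]

theorem surjective_pi_of_linearIndependent {K E ι : Type*} [Field K] [AddCommGroup E] [Module K E]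
    [Fintype ι] {γ : ι → Module.Dual K E} (hγ : LinearIndependent K γ) :
    Function.Surjective (LinearMap.pi γ : E →ₗ[K] (ι → K)) := by
  have h1 : LinearIndependent K (fun i => (γ i : E → K)) :=
    hγ.map' (LinearMap.ltoFun K E K K) (LinearMap.ker_eq_bot.2 DFunLike.coe_injective)
  rw [← span_flip_eq_top_iff_linearIndependent] at h1
  rw [← LinearMap.range_eq_top, eq_top_iff, ← h1, Submodule.span_le]
  rintro _ ⟨x, rfl⟩
  exact ⟨x, rfl⟩

/-- Double counting f (φ x + y) over all pairs. Applied to independent functionals, it says that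
their joint values are uniformly distributed. -/
theorem sum_comp_of_surjective {E H : Type*} [AddCommGroup E] [AddCommGroup H] [Fintype E]
    [Fintype H] (φ : E →+ H) (hφ : Function.Surjective φ) (f : H → ℝ) :
    Fintype.card H * ∑ x, f (φ x) = Fintype.card E * ∑ y, f y := by
  have h1 : ∀ y : H, ∑ x, f (φ x) = ∑ x, f (φ x + y) := by
    intro y
    obtain ⟨z, rfl⟩ := hφ y
    rw [← Equiv.sum_comp (Equiv.addRight z) (fun x => f (φ x))]
    simp
  have h2 : ∀ x : E, ∑ y, f (φ x + y) = ∑ y, f y := fun x =>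
    Equiv.sum_comp (Equiv.addLeft (φ x)) f
  calc _ = ∑ y : H, ∑ x, f (φ x) := by simp
    _ = ∑ y : H, ∑ x, f (φ x + y) := sum_congr rfl fun y _ => h1 y
    _ = _ := by rw [sum_comm]; simp [h2]

/-- Jensen's inequality, from the tangent line to exp at c. -/
theorem exp_mul_card_le_sum_exp {ι : Type*} (s : Finset ι) (g : ι → ℝ) {c : ℝ}
    (h : #s * c ≤ ∑ i ∈ s, g i) : #s * exp c ≤ ∑ i ∈ s, exp (g i) := by
  have key : ∀ i ∈ s, exp c * (1 + (g i - c)) ≤ exp (g i) := by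
    intro i _
    have : exp (g i) = exp c * exp (g i - c) := by rw [← exp_add]; ring_nf
    rw [this]
    gcongr
    linarith [add_one_le_exp (g i - c)]
  calc _ ≤ ∑ i ∈ s, exp c * (1 + (g i - c)) := by
        rw [← mul_sum, sum_add_distrib, sum_sub_distrib]
        simp only [sum_const, nsmul_eq_mul, mul_one]
        nlinarith [exp_pos c]
    _ ≤ _ := sum_le_sum key

/-- Chang's bound: independent functionals in the large spectrum of `X` are few. -/
theorem card_le_of_linearIndependent_spectrum [Fintype G] {X : Finset G} (hX : X.Nonempty)
    {ι : Type*} [Fintype ι] {γ : ι → Module.Dual (ZMod p) G} (hγ : LinearIndependent (ZMod p) γ)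
    (hspec : ∀ i, 1 / 2 < ‖uniformFourier X (γ i)‖) :
    (Fintype.card ι : ℝ) ≤ 16 * log (Fintype.card G / #X) := by
  classical
  have hX' : (0 : ℝ) < #X := by exact_mod_cast hX.card_pos
  have hG : (0 : ℝ) < Fintype.card G := by exact_mod_cast Fintype.card_pos
  have hp : (0 : ℝ) < p := by exact_mod_cast (Fact.out : p.Prime).pos
  -- Phases rotating each coefficient to a positive real: the functions h i below have mean zero on
  -- `ZMod p`, yet h i (γ i x) has mean at least 1/2 on X.
  set c : ι → ℂ := fun i => (starRingEnd ℂ) (uniformFourier X (γ i)) / ‖uniformFourier X (γ i)‖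
  have hpos : ∀ i, 0 < ‖uniformFourier X (γ i)‖ := fun i => by linarith [hspec i]
  have hc : ∀ i, ‖c i‖ = 1 := by
    intro i
    simp only [c, norm_div, RCLike.norm_conj, Complex.norm_real, norm_norm]
    exact div_self (hpos i).ne'
  have hc2 : ∀ i, c i * uniformFourier X (γ i) = ‖uniformFourier X (γ i)‖ := by
    intro i
    have h0 : (‖uniformFourier X (γ i)‖ : ℂ) ≠ 0 := by exact_mod_cast (hpos i).ne'
    simp only [c]
    rw [div_mul_eq_mul_div, Complex.conj_mul', div_eq_iff h0]
    ring
  set h : ι → ZMod p → ℝ := fun i y => (c i * ZMod.stdAddChar y).re with hh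
  have hh1 : ∀ i y, |h i y| ≤ 1 := by
    intro i y
    refine (Complex.abs_re_le_norm _).trans ?_
    rw [norm_mul, hc, norm_stdAddChar, mul_one]
  have hh0 : ∀ i, ∑ y, h i y = 0 := by
    intro i
    simp only [hh]
    rw [← Complex.re_sum, ← mul_sum]
    have : ∑ y : ZMod p, (ZMod.stdAddChar y : ℂ) = 0 := by
      apply AddChar.sum_eq_zero_of_ne_one
      intro h1
      have h2 : (ZMod.stdAddChar (1 : ZMod p) : ℂ) = ZMod.stdAddChar (0 : ZMod p) := by
        rw [h1]; rfl
      exact one_ne_zero (ZMod.injective_stdAddChar h2)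
    simp [this]
  have hhX : ∀ i, #X * (1 / 2 : ℝ) ≤ ∑ x ∈ X, h i (γ i x) := by
    intro i
    have h1 : ((∑ x ∈ X, c i * ZMod.stdAddChar (γ i x) : ℂ)) =
        ((#X * ‖uniformFourier X (γ i)‖ : ℝ) : ℂ) := by
      push_cast
      rw [← hc2 i, ← mul_sum, uniformFourier]
      have : (#X : ℂ) ≠ 0 := by exact_mod_cast hX.card_pos.ne'
      field_simp
    have h2 : ∑ x ∈ X, h i (γ i x) = #X * ‖uniformFourier X (γ i)‖ := by
      rw [← Complex.ofReal_re (#X * ‖uniformFourier X (γ i)‖), ← h1, Complex.re_sum]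
    rw [h2]
    gcongr
    exact (hspec i).le
  set d := Fintype.card ι
  -- By independence the exponential sum factorises over the coordinates. A weight λ gives exponent
  -- λ^2 d here against λ d / 2 on X; λ = 1/4 maximises the gap.
  have hupper : ∑ x : G, exp (∑ i, 1 / 4 * h i (γ i x)) ≤ Fintype.card G * exp (d / 16) := by
    have h1 := sum_comp_of_surjective (LinearMap.pi γ : G →ₗ[ZMod p] (ι → ZMod p)).toAddMonoidHom
      (surjective_pi_of_linearIndependent hγ) (fun y => exp (∑ i, 1 / 4 * h i (y i)))
    have h2 : ∑ y : ι → ZMod p, exp (∑ i, 1 / 4 * h i (y i)) ≤ (p * exp (1 / 16)) ^ d := by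
      calc _ = ∏ i, ∑ y : ZMod p, exp (1 / 4 * h i y) := by
            rw [prod_univ_sum]
            simp [exp_sum]
        _ ≤ ∏ i : ι, (p * exp (1 / 16)) := by
            refine prod_le_prod (fun _ _ => sum_nonneg fun _ _ => (exp_pos _).le) fun i _ => ?_
            have := sum_exp_mul_le univ (h i) (fun y _ => hh1 i y) (hh0 i)
              (l := 1 / 4) (by norm_num [abs_le])
            rw [card_univ, ZMod.card] at this
            refine this.trans (le_of_eq ?_)
            norm_num
        _ = _ := by simp [d]
    have h3 : (Fintype.card (ι → ZMod p) : ℝ) = (p : ℝ) ^ d := by simp [d]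
    rw [h3] at h1
    have h4 : (p : ℝ) ^ d * ∑ x : G, exp (∑ i, 1 / 4 * h i (γ i x)) ≤
        p ^ d * (Fintype.card G * exp (d / 16)) := by
      refine h1.le.trans ?_
      calc _ ≤ (Fintype.card G : ℝ) * (p * exp (1 / 16)) ^ d := by gcongr
        _ = _ := by rw [mul_pow, ← exp_nat_mul]; ring_nf
    exact le_of_mul_le_mul_left h4 (by positivity)
  have hlower : #X * exp (d / 8) ≤ ∑ x ∈ X, exp (∑ i, 1 / 4 * h i (γ i x)) := by
    apply exp_mul_card_le_sum_exp
    rw [sum_comm]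
    calc (#X : ℝ) * (d / 8) = ∑ i : ι, 1 / 4 * (#X * (1 / 2 : ℝ)) := by simp [d]; ring
      _ ≤ _ := by
        refine sum_le_sum fun i _ => ?_
        rw [← mul_sum]
        linarith [hhX i]
  have hle : #X * exp (d / 8) ≤ Fintype.card G * exp (d / 16) :=
    hlower.trans ((sum_le_sum_of_subset_of_nonneg (subset_univ _)
      fun _ _ _ => (exp_pos _).le).trans hupper)
  have hfin : exp ((d : ℝ) / 16) ≤ Fintype.card G / #X := by
    rw [le_div_iff₀ hX']
    have h1 : exp ((d : ℝ) / 8) = exp (d / 16) * exp (d / 16) := by rw [← exp_add]; ring_nf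
    rw [h1] at hle
    nlinarith [exp_pos ((d : ℝ) / 16)]
  have := (le_log_iff_exp_le (by positivity)).2 hfin
  linarith

/-- The vectors killed by the large spectrum of `X` form a subspace of small codimension. -/
theorem exists_submodule_annihilating_spectrum [Fintype G] {X : Finset G} (hX : X.Nonempty) :
    ∃ V : Submodule (ZMod p) G,
      (∀ v ∈ V, ∀ ℓ : Module.Dual (ZMod p) G, 1 / 2 < ‖uniformFourier X ℓ‖ → ℓ v = 0) ∧
      (Module.finrank (ZMod p) G : ℝ) ≤
        Module.finrank (ZMod p) V + 16 * log (Fintype.card G / #X) := by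
  classical
  obtain ⟨b, hb, hspan, hli⟩ := exists_linearIndependent (ZMod p)
    {ℓ : Module.Dual (ZMod p) G | 1 / 2 < ‖uniformFourier X ℓ‖}
  have : Finite (Module.Dual (ZMod p) G) := Module.finite_of_finite (ZMod p)
  have : Fintype b := Fintype.ofFinite b
  set W := Submodule.span (ZMod p) {ℓ : Module.Dual (ZMod p) G | 1 / 2 < ‖uniformFourier X ℓ‖}
  refine ⟨W.dualCoannihilator, ?_, ?_⟩
  · intro v hv ℓ hℓ
    exact (Submodule.mem_dualCoannihilator v).1 hv ℓ (Submodule.subset_span hℓ)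
  · have h1 := Subspace.finrank_add_finrank_dualCoannihilator_eq W
    have h2 : Module.finrank (ZMod p) W = Fintype.card b := by
      have := finrank_span_eq_card hli
      rwa [Subtype.range_coe, hspan] at this
    have h3 := card_le_of_linearIndependent_spectrum hX hli fun i => hb i.2
    rw [← h1, h2]
    push_cast
    linarith

end Chang

/-! ### The Bogolyubov lemma for dense sets. -/

section Dense

variable {p : ℕ} [Fact p.Prime] {G : Type*} [AddCommGroup G] [Module (ZMod p) G] [Fintype G]
  [DecidableEq G]

/-- A quasipolynomial Bogolyubov lemma for dense sets with explicit parameters. -/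
theorem exists_submodule_subset_of_parameters {A S : Finset G} (hA : A.Nonempty) (hS : S.Nonempty)
    {α : ℝ} (hα : 0 < α) (hAα : α * Fintype.card G ≤ #A) (hSα : α * Fintype.card G ≤ #S)
    {m k : ℕ} (hm : 0 < m) (hk : 0 < k) (hm4 : 8 * (1 / 4) ^ m ≤ α)
    (hkm : 64 * m * exp (-(k / (1024 * m ^ 2))) ≤ α) :
    ∃ V : Submodule (ZMod p) G, (V : Set G) ⊆ ((A + S - (A + S) : Finset G) : Set G) ∧
      (Module.finrank (ZMod p) G : ℝ) ≤
        Module.finrank (ZMod p) V + 16 * (log 2 + k * log (1 / α)) := by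
  classical
  have : Finite (Module.Dual (ZMod p) G) := Module.finite_of_finite (ZMod p)
  have : Fintype (Module.Dual (ZMod p) G) := Fintype.ofFinite _
  have hG : (0 : ℝ) < Fintype.card G := by exact_mod_cast Fintype.card_pos
  have hA' : (0 : ℝ) < #A := by exact_mod_cast hA.card_pos
  have hS' : (0 : ℝ) < #S := by exact_mod_cast hS.card_pos
  have hm' : (1 : ℝ) ≤ m := by exact_mod_cast hm
  set f : G → ℝ := fun x => if x ∈ A + S then 1 else 0 with hfdef
  have hf : ∀ x, f x ∈ Set.Icc (0 : ℝ) 1 := by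
    intro x; simp only [hfdef]; split_ifs <;> simp
  -- Chosen so that the total drift of m averagings, m * (4 * ε), is 1/4.
  set ε : ℝ := 1 / (16 * m) with hεdef
  have hε : 0 < ε := by positivity
  have hε1 : ε ≤ 1 := by rw [hεdef, div_le_one (by positivity)]; linarith
  have hmain : 4 * Fintype.card G * exp (-(ε ^ 2 * k / 4)) ≤ ε * #S := by
    have h1 : ε ^ 2 * k / 4 = k / (1024 * m ^ 2) := by rw [hεdef]; field_simp; norm_num
    have h2 : 4 * exp (-(k / (1024 * (m : ℝ) ^ 2))) ≤ ε * α := by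
      rw [hεdef, one_div_mul_eq_div, le_div_iff₀ (by positivity)]
      linarith
    rw [h1]
    calc _ = Fintype.card G * (4 * exp (-(k / (1024 * (m : ℝ) ^ 2)))) := by ring
      _ ≤ Fintype.card G * (ε * α) := by gcongr
      _ = ε * (α * Fintype.card G) := by ring
      _ ≤ _ := by gcongr
  obtain ⟨X, hXcard, hXper⟩ := exists_almost_periods hA hS hf hk hε hε1 hmain
  have hXpos : (0 : ℝ) < #X := by
    have h1 : 0 < (Fintype.card G : ℝ) * (#A : ℝ) ^ k := by positivity
    have h2 := h1.trans_le hXcard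
    by_contra hcon
    have h3 : (#X : ℝ) = 0 := le_antisymm (not_lt.1 hcon) (by positivity)
    rw [h3] at h2
    simp at h2
  have hX : X.Nonempty := card_pos.1 (by exact_mod_cast hXpos)
  obtain ⟨V, hV, hdim⟩ := exists_submodule_annihilating_spectrum (p := p) hX
  refine ⟨V, ?_, ?_⟩
  · intro v hv
    set F := shiftAverage A (shiftAverage S f) with hF
    have hF0 : F 0 = 1 := by
      have h1 : ∀ a ∈ A, shiftAverage S f (0 + a) = 1 := by
        intro a ha
        rw [shiftAverage, div_eq_one_iff_eq hS'.ne', sum_congr rfl (g := fun _ => (1 : ℝ))]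
        · simp
        · intro s hs
          simp only [hfdef, zero_add, if_pos (add_mem_add ha hs)]
      rw [hF, shiftAverage, sum_congr rfl h1]
      simp [hA'.ne']
    have hit := abs_diffAverage_iterate_sub_le hX hXper m
    have hmε : m * (4 * ε) = 1 / 4 := by rw [hεdef]; field_simp; norm_num
    rw [hmε] at hit
    have h1 := abs_le.1 (hit v)
    have h2 := abs_le.1 (hit 0)
    have h3 := abs_le.1 (abs_diffAverage_iterate_sub_zero_le (p := p) (X := X) hA hS hα hAα hSα hf m
      (hV v hv))
    have h4 : 2 * (1 / 4 : ℝ) ^ m * (1 / α) ≤ 1 / 4 := by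
      rw [mul_one_div, div_le_iff₀ hα]; linarith
    -- From F 0 = 1, three errors of at most 1/4 each are lost: smoothing at 0, passing from 0 to v,
    -- and unsmoothing at v.
    have hFv : 0 < F v := by
      rw [← hF] at h3
      linarith [h1.2, h2.1, h3.1]
    have hne : ∃ a ∈ A, ∃ s ∈ S, v + a + s ∈ A + S := by
      by_contra hcon
      push Not at hcon
      have : F v = 0 := by
        rw [hF, shiftAverage, sum_eq_zero, zero_div]
        intro a ha
        rw [shiftAverage, sum_eq_zero, zero_div]
        intro s hs
        simp only [hfdef, if_neg (hcon a ha s hs)]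
      linarith
    obtain ⟨a, ha, s, hs, hvas⟩ := hne
    rw [mem_coe, mem_sub]
    exact ⟨_, hvas, a + s, add_mem_add ha hs, by abel⟩
  · refine hdim.trans ?_
    have h1 : (Fintype.card G : ℝ) / #X ≤ 2 * (1 / α) ^ k := by
      rw [div_le_iff₀ hXpos]
      have h2 : (Fintype.card G : ℝ) * (α * Fintype.card G) ^ k ≤
          2 * #X * (Fintype.card G : ℝ) ^ k := le_trans (by gcongr) hXcard
      have h3 : (Fintype.card G : ℝ) * α ^ k ≤ 2 * #X := by
        rw [mul_pow, ← mul_assoc] at h2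
        exact le_of_mul_le_mul_right h2 (by positivity)
      rw [one_div, inv_pow]
      calc (Fintype.card G : ℝ) = Fintype.card G * α ^ k * (α ^ k)⁻¹ := by
            field_simp
        _ ≤ 2 * #X * (α ^ k)⁻¹ := by gcongr
        _ = _ := by ring
    have h2 := log_le_log (by positivity) h1
    rw [log_mul (by norm_num) (by positivity), log_pow] at h2
    linarith

/-- A quasipolynomial Bogolyubov lemma for dense sets. -/
theorem exists_submodule_subset_of_dense {A S : Finset G} {α : ℝ} (hα : 0 < α) (hα2 : α ≤ 1 / 2)
    (hAα : α * Fintype.card G ≤ #A) (hSα : α * Fintype.card G ≤ #S) :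
    ∃ V : Submodule (ZMod p) G, (V : Set G) ⊆ ((A + S - (A + S) : Finset G) : Set G) ∧
      (Module.finrank (ZMod p) G : ℝ) ≤ Module.finrank (ZMod p) V + 10 ^ 7 * log (1 / α) ^ 4 := by
  have hG : (0 : ℝ) < Fintype.card G := by exact_mod_cast Fintype.card_pos
  have hA : A.Nonempty := card_pos.1 (by exact_mod_cast (by positivity : 0 < α * _).trans_le hAα)
  have hS : S.Nonempty := card_pos.1 (by exact_mod_cast (by positivity : 0 < α * _).trans_le hSα)
  set L := log (1 / α) with hL
  have hL2 : log 2 ≤ L := log_le_log (by norm_num) (by rw [le_div_iff₀ hα]; linarith)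
  have hL0 : 0.69 < L := by linarith [log_two_gt_d9]
  have hexp : exp (-L) = α := by rw [hL, one_div, log_inv, neg_neg, exp_log hα]
  have hLα : L * α ≤ 1 := by
    have h1 := add_one_le_exp L
    have h2 : exp L * α = 1 := by rw [← hexp, ← exp_add]; simp
    nlinarith
  -- Then 4^(-m) ≤ α ^ 5, more than enough to beat α / 8.
  set m := ⌈5 * L⌉₊ with hmdef
  have hm1 : 5 * L ≤ m := Nat.le_ceil _
  have hm2 : (m : ℝ) ≤ 7 * L := by
    have := (Nat.ceil_lt_add_one (by positivity : 0 ≤ 5 * L)).le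
    linarith
  have hmpos : (0 : ℝ) < m := by linarith
  -- Here 11264 = 11 * 1024, so the exponential is at most α ^ 11: one factor absorbs L, nine absorb
  -- 448 < 2 ^ 9, and one remains.
  set k := ⌈11264 * L * (m : ℝ) ^ 2⌉₊ with hkdef
  have hk1 : 11264 * L * (m : ℝ) ^ 2 ≤ k := Nat.le_ceil _
  have hk2 : (k : ℝ) ≤ 11264 * L * (m : ℝ) ^ 2 + 1 :=
    (Nat.ceil_lt_add_one (by positivity : 0 ≤ 11264 * L * (m : ℝ) ^ 2)).le
  have hkpos : (0 : ℝ) < k := lt_of_lt_of_le (by positivity) hk1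
  have hm4 : 8 * (1 / 4 : ℝ) ^ m ≤ α := by
    have h1 : (1 / 4 : ℝ) ^ m ≤ exp (-(5 * L)) := by
      calc (1 / 4 : ℝ) ^ m ≤ exp (-1) ^ m := by
            gcongr
            rw [exp_neg, ← one_div]
            gcongr
            linarith [exp_one_lt_d9]
        _ = exp (-m) := by rw [← exp_nat_mul]; ring_nf
        _ ≤ _ := by gcongr
    have h2 : exp (-(5 * L)) = α ^ 5 := by
      rw [← hexp, ← exp_nat_mul]; push_cast; ring_nf
    have h3 : α ^ 4 ≤ (1 / 2) ^ 4 := by gcongr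
    rw [h2] at h1
    nlinarith
  have hkm : 64 * m * exp (-(k / (1024 * (m : ℝ) ^ 2))) ≤ α := by
    have h1 : 11 * L ≤ k / (1024 * (m : ℝ) ^ 2) := by
      rw [le_div_iff₀ (by positivity)]; linarith
    have h2 : exp (-(k / (1024 * (m : ℝ) ^ 2))) ≤ α ^ 11 := by
      rw [← hexp, ← exp_nat_mul]
      gcongr
      push_cast
      linarith
    have h3 : α ^ 9 ≤ (1 / 2) ^ 9 := by gcongr
    calc 64 * m * exp (-(k / (1024 * (m : ℝ) ^ 2))) ≤ 64 * (7 * L) * α ^ 11 := by gcongr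
      _ = 448 * (L * α) * α ^ 9 * α := by ring
      _ ≤ 448 * 1 * (1 / 2) ^ 9 * α := by gcongr
      _ ≤ α := by norm_num; linarith
  obtain ⟨V, hV, hdim⟩ := exists_submodule_subset_of_parameters (p := p) hA hS hα hAα hSα
    (by exact_mod_cast hmpos) (by exact_mod_cast hkpos) hm4 hkm
  refine ⟨V, hV, hdim.trans ?_⟩
  have h1 : (k : ℝ) ≤ 551936 * L ^ 3 + 1 := by
    refine hk2.trans ?_
    have : (m : ℝ) ^ 2 ≤ (7 * L) ^ 2 := by gcongr
    nlinarith
  have h2 : 1 ≤ 4 * L ^ 3 := by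
    have : (0.69 : ℝ) ^ 3 ≤ L ^ 3 := by gcongr
    norm_num at this
    linarith
  have h3 : log 2 + k * L ≤ (k + 1) * L := by linarith
  have h4 : (k + 1) * L ≤ 551944 * L ^ 3 * L := by gcongr; linarith
  have h5 : 0 ≤ L ^ 3 * L := by positivity
  nlinarith

end Dense

/-! ### Sumset estimates and the case of very small doubling. -/

section SmallDoubling

variable {G : Type*} [AddCommGroup G] [DecidableEq G]

theorem card_nsmul_sub_nsmul_le {A B : Finset G} (hA : A.Nonempty) {K : ℝ}
    (h : (#(A + B) : ℝ) ≤ K * #A) (m n : ℕ) :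
    (#(m • B - n • B) : ℝ) ≤ K ^ (m + n) * #A := by
  have hA' : (0 : ℝ) < #A := by exact_mod_cast hA.card_pos
  have h1 := pluennecke_ruzsa_inequality_nsmul_sub_nsmul_add hA B m n
  have h2 : (#(m • B - n • B) : ℝ) ≤ (#(A + B) / #A : ℝ) ^ (m + n) * #A := by
    have h3 := (NNRat.cast_le (K := ℝ)).2 h1
    push_cast at h3
    exact h3
  refine h2.trans ?_
  gcongr
  rwa [div_le_iff₀ hA']

/-- Plünnecke-type bound for the threefold difference set of a sumset. -/
theorem card_nsmul_add_sub_nsmul_add_le {A S : Finset G} (hA : A.Nonempty) (hS : S.Nonempty)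
    {K : ℝ} (hK : 0 ≤ K) (hKA : (#(A + S) : ℝ) ≤ K * #A) (hKS : (#(A + S) : ℝ) ≤ K * #S) :
    (#(3 • (A + S) - 3 • (A + S)) : ℝ) ≤ K ^ 15 * #S := by
  have hA' : (0 : ℝ) < #A := by exact_mod_cast hA.card_pos
  have hS' : (0 : ℝ) < #S := by exact_mod_cast hS.card_pos
  have h4 : ∀ B : Finset G, B + (3 • B - 3 • B) = 4 • B - 3 • B := by
    intro B
    rw [← add_sub_assoc, ← succ_nsmul']
  have h4' : ∀ B : Finset G, B - (3 • B - 3 • B) = 4 • B - 3 • B := by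
    intro B
    rw [← h4, sub_eq_add_neg B, neg_sub]
  have hAA : (#(4 • A - 3 • A) : ℝ) ≤ K ^ 7 * #S :=
    card_nsmul_sub_nsmul_le hS (by rwa [add_comm]) 4 3
  have hSS : (#(4 • S - 3 • S) : ℝ) ≤ K ^ 7 * #A := card_nsmul_sub_nsmul_le hA hKA 4 3
  -- Ruzsa's triangle inequality through S, then below through A; the exponents add up as (1 + 7) +
  -- 7 = 15.
  have h1 : (#(A + (3 • S - 3 • S)) : ℝ) ≤ K ^ 8 * #A := by
    have h := ruzsa_triangle_inequality_add_add_add A S (3 • S - 3 • S)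
    rw [h4] at h
    have h' : (#(A + (3 • S - 3 • S)) : ℝ) * #S ≤ #(A + S) * #(4 • S - 3 • S) := by exact_mod_cast h
    refine le_of_mul_le_mul_right ?_ hS'
    calc _ ≤ _ := h'
      _ ≤ (K * #S) * (K ^ 7 * #A) := by gcongr
      _ = _ := by ring
  have h2 := ruzsa_triangle_inequality_add_sub_add (3 • A - 3 • A) A (3 • S - 3 • S)
  rw [h4', ← add_sub_add_comm, ← nsmul_add] at h2
  have h2' : (#A : ℝ) * #(3 • (A + S) - 3 • (A + S)) ≤
      #(4 • A - 3 • A) * #(A + (3 • S - 3 • S)) := by exact_mod_cast h2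
  refine le_of_mul_le_mul_left ?_ hA'
  calc _ ≤ _ := h2'
    _ ≤ (K ^ 7 * #S) * (K ^ 8 * #A) := by gcongr
    _ = _ := by ring

/-- If `|A + S| < 3/2 |A|`, each difference of `S` is a popular difference of `A`. -/
theorem two_mul_card_inter_vadd_gt {A S : Finset G} (h : 2 * #(A + S) < 3 * #A) {d : G}
    (hd : d ∈ S - S) : #A < 2 * #{a ∈ A | a + d ∈ A} := by
  obtain ⟨s, hs, t, ht, rfl⟩ := mem_sub.1 hd
  have h1 : #(A.image (· + s) ∪ A.image (· + t)) ≤ #(A + S) := by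
    refine card_le_card (union_subset ?_ ?_) <;> intro x hx <;>
      obtain ⟨a, ha, rfl⟩ := mem_image.1 hx
    · exact add_mem_add ha hs
    · exact add_mem_add ha ht
  have h2 := card_union_add_card_inter (A.image (· + s)) (A.image (· + t))
  rw [card_image_of_injective _ (add_left_injective s),
    card_image_of_injective _ (add_left_injective t)] at h2
  have h3 : #(A.image (· + s) ∩ A.image (· + t)) ≤ #{a ∈ A | a + (s - t) ∈ A} := by
    refine card_le_card_of_injOn (· - s) ?_ ((sub_left_injective (b := s)).injOn)
    intro x hx
    obtain ⟨hx1, hx2⟩ := mem_inter.1 (mem_coe.1 hx)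
    obtain ⟨a, ha, rfl⟩ := mem_image.1 hx1
    obtain ⟨b, hb, hab⟩ := mem_image.1 hx2
    have : b = a + (s - t) := by
      rw [← add_sub_assoc, ← hab, add_sub_cancel_right]
    simp only [coe_filter, Set.mem_ofPred_eq, add_sub_cancel_right]
    exact ⟨ha, this ▸ hb⟩
  omega

/-- More than half of the a in A have a + d in A, and likewise for e; a common a gives d - e = (a +
d) - (a + e). -/
theorem sub_mem_of_mem_sub {A S : Finset G} (h : 2 * #(A + S) < 3 * #A) {d e : G}
    (hd : d ∈ S - S) (he : e ∈ S - S) : d - e ∈ A - A := by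
  have h1 := two_mul_card_inter_vadd_gt h hd
  have h2 := two_mul_card_inter_vadd_gt h he
  have h3 := card_union_add_card_inter {a ∈ A | a + d ∈ A} {a ∈ A | a + e ∈ A}
  have h4 : #({a ∈ A | a + d ∈ A} ∪ {a ∈ A | a + e ∈ A}) ≤ #A :=
    card_le_card (union_subset (filter_subset _ _) (filter_subset _ _))
  obtain ⟨a, ha⟩ : ({a ∈ A | a + d ∈ A} ∩ {a ∈ A | a + e ∈ A}).Nonempty :=
    card_pos.1 (by omega)
  simp only [mem_inter, mem_filter] at ha
  exact mem_sub.2 ⟨a + d, ha.1.2, a + e, ha.2.2, by abel⟩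

/-- If `|A + S| < 3/2 min(|A|, |S|)` then `A + S` is a coset of a subgroup. -/
theorem exists_addSubgroup_of_card_add_lt {A S : Finset G} (hA : A.Nonempty) (hS : S.Nonempty)
    (h1 : 2 * #(A + S) < 3 * #A) (h2 : 2 * #(A + S) < 3 * #S) :
    ∃ H : AddSubgroup G, (H : Set G) ⊆ ((A - A + (S - S) : Finset G) : Set G) ∧
      Nat.card H = #(A + S) := by
  have h2' : 2 * #(S + A) < 3 * #S := by rwa [add_comm]
  obtain ⟨a₀, ha₀⟩ := hA
  obtain ⟨s₀, hs₀⟩ := hS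
  have hA0 : (0 : G) ∈ A - A := mem_sub.2 ⟨a₀, ha₀, a₀, ha₀, sub_self _⟩
  have hS0 : (0 : G) ∈ S - S := mem_sub.2 ⟨s₀, hs₀, s₀, hs₀, sub_self _⟩
  have hAS : A - A ⊆ S - S := fun d hd => by simpa using sub_mem_of_mem_sub h2' hd hA0
  have hSA : S - S ⊆ A - A := fun d hd => by simpa using sub_mem_of_mem_sub h1 hd hS0
  have heq : A - A = S - S := hAS.antisymm hSA
  let H : AddSubgroup G := AddSubgroup.ofSub ((A - A : Finset G) : Set G) ⟨0, hA0⟩ (by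
    intro x hx y hy
    have := sub_mem_of_mem_sub h1 (hAS hx) (hAS hy)
    rwa [sub_eq_add_neg x] at this)
  have hH : ∀ x, x ∈ H ↔ x ∈ A - A := fun x => Iff.rfl
  refine ⟨H, ?_, ?_⟩
  · intro x hx
    exact mem_add.2 ⟨x, hx, 0, hS0, add_zero x⟩
  · have hcardH : Nat.card H = #(A - A) := by
      change Nat.card ((A - A : Finset G) : Set G) = _
      rw [Nat.card_coe_set_eq, Set.ncard_coe_finset]
    -- Each difference has more than |B| / 2 representations among |B|^2 pairs.
    have hdouble : ∀ {B C : Finset G}, 2 * #(B + C) < 3 * #B → B - B = C - C → B.Nonempty →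
        #(B - B) < 2 * #B := by
      intro B C hBC hBeq hBne
      have hsum : ∑ d ∈ B - B, #{a ∈ B | a + d ∈ B} ≤ #B * #B := by
        simp only [card_filter]
        rw [sum_comm, ← smul_eq_mul]
        refine sum_le_card_nsmul _ _ _ fun a _ => ?_
        rw [← card_filter]
        refine card_le_card_of_injOn (a + ·) ?_ ((add_right_injective a).injOn)
        intro d hd
        exact (mem_filter.1 (mem_coe.1 hd)).2
      have hlow : ∑ d ∈ B - B, #B < ∑ d ∈ B - B, 2 * #{a ∈ B | a + d ∈ B} := by
        refine sum_lt_sum_of_nonempty (hBne.sub hBne) fun d hd => ?_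
        exact two_mul_card_inter_vadd_gt hBC (hBeq ▸ hd)
      rw [← mul_sum, sum_const, smul_eq_mul] at hlow
      have hpos := hBne.card_pos
      have : #(B - B) * #B < 2 * #B * #B := by nlinarith
      exact lt_of_mul_lt_mul_right this (Nat.zero_le _)
    have hcA := hdouble h1 heq ⟨a₀, ha₀⟩
    have hcS := hdouble h2' heq.symm ⟨s₀, hs₀⟩
    rw [hcardH]
    have : A + S = (A - A).image (· + (a₀ + s₀)) := by
      ext x
      constructor
      · intro hx
        obtain ⟨a, ha, s, hs, rfl⟩ := mem_add.1 hx
        refine mem_image.2 ⟨(a - a₀) + (s - s₀), ?_, by abel⟩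
        exact H.add_mem (sub_mem_sub ha ha₀) (hSA (sub_mem_sub hs hs₀))
      · intro hx
        obtain ⟨d, hd, rfl⟩ := mem_image.1 hx
        -- A₁ and S₁ each fill more than half of the subgroup, so they meet, which writes d as (a -
        -- a₀) + (s - s₀).
        set A₁ := A.image (· - a₀)
        set S₁ := S.image (fun s => d - (s - s₀))
        have hA1 : A₁ ⊆ A - A := by
          intro y hy
          obtain ⟨a, ha, rfl⟩ := mem_image.1 hy
          exact sub_mem_sub ha ha₀
        have hS1 : S₁ ⊆ A - A := by
          intro y hy
          obtain ⟨s, hs, rfl⟩ := mem_image.1 hy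
          exact H.sub_mem hd (hSA (sub_mem_sub hs hs₀))
        have e1 : #A₁ = #A := card_image_of_injective _ sub_left_injective
        have e2 : #S₁ = #S := card_image_of_injective _ fun x y hxy => by
          simpa using hxy
        have e3 := card_union_add_card_inter A₁ S₁
        have e4 := card_le_card (union_subset hA1 hS1)
        have e5 : #(S - S) = #(A - A) := by rw [heq]
        obtain ⟨y, hy⟩ : (A₁ ∩ S₁).Nonempty := card_pos.1 (by omega)
        obtain ⟨hy1, hy2⟩ := mem_inter.1 hy
        obtain ⟨a, ha, rfl⟩ := mem_image.1 hy1
        obtain ⟨s, hs, hsa⟩ := mem_image.1 hy2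
        refine mem_add.2 ⟨a, ha, s, hs, ?_⟩
        have : d = (a - a₀) + (s - s₀) := by rw [← hsa]; abel
        rw [this]; abel
    rw [this, card_image_of_injective _ (add_left_injective _)]

end SmallDoubling

/-! ### Modelling in a small quotient and lifting back. -/

section Model

variable {p : ℕ} [Fact p.Prime] {G : Type*} [AddCommGroup G] [Module (ZMod p) G]

/-- A quotient of bounded size in which no non-zero element of `D` vanishes. -/
theorem exists_submodule_inter_trivial [Finite G] {D : Finset G} (hD : 0 ∈ D) :
    ∃ U : Submodule (ZMod p) G, (∀ x ∈ U, x ∈ D → x = 0) ∧ Nat.card (G ⧸ U) ≤ p * #D := by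
  have : Finite (Submodule (ZMod p) G) := Finite.of_injective _ SetLike.coe_injective
  obtain ⟨U, hU⟩ := (Set.toFinite {U : Submodule (ZMod p) G | ∀ x ∈ U, x ∈ D → x = 0}).exists_maximal
    ⟨⊥, by simp⟩
  refine ⟨U, hU.prop, ?_⟩
  -- By maximality of U, adjoining x outside U captures some non-zero u + c • x in D with c ≠ 0, so
  -- x is a scalar multiple of an element of D modulo U.
  have hsurj : Function.Surjective (fun cd : ZMod p × D => U.mkQ (cd.1 • (cd.2 : G))) := by
    intro y
    obtain ⟨x, rfl⟩ := U.mkQ_surjective y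
    by_cases hx : x ∈ U
    · refine ⟨(0, ⟨0, hD⟩), ?_⟩
      simp [(Submodule.Quotient.mk_eq_zero U).2 hx]
    · have hlt : ¬ ∀ z ∈ U ⊔ Submodule.span (ZMod p) {x}, z ∈ D → z = 0 := by
        intro hcon
        have := hU.le_of_ge (y := U ⊔ Submodule.span (ZMod p) {x}) hcon le_sup_left
        exact hx (this (Submodule.mem_sup_right (Submodule.mem_span_singleton_self x)))
      push Not at hlt
      obtain ⟨z, hz, hzD, hz0⟩ := hlt
      obtain ⟨u, hu, w, hw, rfl⟩ := Submodule.mem_sup.1 hz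
      obtain ⟨c, rfl⟩ := Submodule.mem_span_singleton.1 hw
      have hc : c ≠ 0 := by
        rintro rfl
        rw [zero_smul, add_zero] at hzD hz0
        exact hz0 (hU.prop u hu hzD)
      refine ⟨(c⁻¹, ⟨u + c • x, hzD⟩), ?_⟩
      have hu0 : U.mkQ u = 0 := (Submodule.Quotient.mk_eq_zero U).2 hu
      simp only [map_smul, map_add, hu0, zero_add, smul_smul, inv_mul_cancel₀ hc, one_smul]
  have := Nat.card_le_card_of_surjective _ hsurj
  simpa [Nat.card_prod] using this

variable [DecidableEq G]

/-- Subspaces inside a difference set lift along a quotient which is injective enough. -/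
theorem exists_submodule_lift {B : Finset G} {U : Submodule (ZMod p) G}
    (hU : ∀ x ∈ U, x ∈ 3 • B - 3 • B → x = 0) {V' : Submodule (ZMod p) (G ⧸ U)}
    (hV' : ∀ v ∈ V', ∃ d ∈ B - B, U.mkQ d = v) :
    ∃ V : Submodule (ZMod p) G, (V : Set G) ⊆ ((B - B : Finset G) : Set G) ∧
      Module.finrank (ZMod p) V = Module.finrank (ZMod p) V' := by
  have hD : (B - B) + (B - B) - (B - B) = 3 • B - 3 • B := by
    rw [succ_nsmul, two_nsmul]
    simp only [sub_eq_add_neg, neg_add, neg_neg]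
    ac_rfl
  -- Here d₁ + d₂ - d₃ lies in U and in 3B - 3B, hence is zero; this is why threefold sums are
  -- needed.
  have key : ∀ d₁ ∈ B - B, ∀ d₂ ∈ B - B, ∀ d₃ ∈ B - B, U.mkQ d₃ = U.mkQ (d₁ + d₂) → d₃ = d₁ + d₂ := by
    intro d₁ h₁ d₂ h₂ d₃ h₃ h
    have := hU (d₁ + d₂ - d₃) ((Submodule.Quotient.eq U).1 h.symm)
      (hD ▸ sub_mem_sub (add_mem_add h₁ h₂) h₃)
    exact (sub_eq_zero.1 this).symm
  obtain ⟨d₀, hd₀, -⟩ := hV' 0 V'.zero_mem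
  have h0 : (0 : G) ∈ B - B := by
    obtain ⟨b, hb, -⟩ := mem_sub.1 hd₀
    exact mem_sub.2 ⟨b, hb, b, hb, sub_self b⟩
  have hneg : ∀ d ∈ B - B, -d ∈ B - B := by
    intro d hd
    obtain ⟨b, hb, c, hc, rfl⟩ := mem_sub.1 hd
    exact mem_sub.2 ⟨c, hc, b, hb, (neg_sub b c).symm⟩
  let H : AddSubgroup G :=
    { carrier := {d | d ∈ B - B ∧ U.mkQ d ∈ V'}
      zero_mem' := ⟨h0, by simp⟩
      neg_mem' := by
        rintro x ⟨hx, hx'⟩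
        exact ⟨hneg x hx, by rw [map_neg]; exact V'.neg_mem hx'⟩
      add_mem' := by
        rintro x y ⟨hx, hx'⟩ ⟨hy, hy'⟩
        have hxy : U.mkQ (x + y) ∈ V' := by rw [map_add]; exact V'.add_mem hx' hy'
        obtain ⟨d, hd, hd'⟩ := hV' _ hxy
        exact ⟨key x hx y hy d hd hd' ▸ hd, hxy⟩ }
  let V := AddSubgroup.toZModSubmodule p H
  have hVmem : ∀ x, x ∈ V ↔ x ∈ B - B ∧ U.mkQ x ∈ V' := fun x => Iff.rfl
  refine ⟨V, fun x hx => ((hVmem x).1 hx).1, ?_⟩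
  refine LinearEquiv.finrank_eq (LinearEquiv.ofBijective
    (U.mkQ.restrict (p := V) (q := V') fun x hx => ((hVmem x).1 hx).2) ⟨?_, ?_⟩)
  · rintro ⟨x, hx⟩ ⟨y, hy⟩ hxy
    have hxy' : U.mkQ x = U.mkQ y := congrArg Subtype.val hxy
    have := key y ((hVmem y).1 hy).1 0 h0 x ((hVmem x).1 hx).1 (by simpa using hxy')
    simpa using this
  · rintro ⟨v, hv⟩
    obtain ⟨d, hd, rfl⟩ := hV' v hv
    exact ⟨⟨d, hd, hv⟩, rfl⟩

/-- A quasipolynomial Bogolyubov–Ruzsa lemma over `ZMod p`. -/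
theorem exists_submodule_subset_of_small_sumset [Finite G] {A S : Finset G} (hA : A.Nonempty)
    (hS : S.Nonempty) {K : ℝ} (hK : 1 ≤ K) (hKA : (#(A + S) : ℝ) ≤ K * #A) (hKS : (#(A + S) : ℝ) ≤ K * #S) :
    ∃ V : Submodule (ZMod p) G, (V : Set G) ⊆ ((A - A + (S - S) : Finset G) : Set G) ∧
      logb p #(A + S) ≤ Module.finrank (ZMod p) V + 10 ^ 7 * (log p + 16 * log K) ^ 4 ∧
      (Nat.card V : ℝ) ≤ K ^ 15 * #(A + S) := by
  classical
  have hA' : (0 : ℝ) < #A := by exact_mod_cast hA.card_pos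
  have hS' : (0 : ℝ) < #S := by exact_mod_cast hS.card_pos
  have hp2 : (2 : ℝ) ≤ p := by exact_mod_cast (Fact.out : p.Prime).two_le
  have hAS : (0 : ℝ) < #(A + S) := by exact_mod_cast (hA.add hS).card_pos
  have hSle : (#S : ℝ) ≤ #(A + S) := by exact_mod_cast card_le_card_add_left hA
  have hDcard := card_nsmul_add_sub_nsmul_add_le hA hS (by linarith) hKA hKS
  set B := A + S with hB
  set D := 3 • B - 3 • B with hDdef
  have hBne : B.Nonempty := hA.add hS
  have hD0 : (0 : G) ∈ D := by
    obtain ⟨b, hb⟩ := hBne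
    exact mem_sub.2 ⟨3 • b, nsmul_mem_nsmul hb, 3 • b, nsmul_mem_nsmul hb, sub_self _⟩
  have hBD : B - B ⊆ D := by
    intro x hx
    obtain ⟨b, hb, c, hc, rfl⟩ := mem_sub.1 hx
    refine mem_sub.2 ⟨2 • b + b, ?_, 2 • b + c, ?_, by abel⟩ <;> rw [succ_nsmul]
    · exact add_mem_add (nsmul_mem_nsmul hb) hb
    · exact add_mem_add (nsmul_mem_nsmul hb) hc
  obtain ⟨U, hU, hUcard⟩ := exists_submodule_inter_trivial (p := p) hD0
  have : Finite (G ⧸ U) := Finite.of_surjective _ U.mkQ_surjective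
  have : Fintype (G ⧸ U) := Fintype.ofFinite _
  have hQ : (Fintype.card (G ⧸ U) : ℝ) ≤ p * #D := by
    rw [← Nat.card_eq_fintype_card]; exact_mod_cast hUcard
  have hinj : Set.InjOn U.mkQ (B : Set G) := by
    intro x hx y hy hxy
    exact sub_eq_zero.1 (hU _ ((Submodule.Quotient.eq U).1 hxy) (hBD (sub_mem_sub hx hy)))
  have himage : ∀ {C : Finset G} (t : G), (∀ c ∈ C, c + t ∈ B) → #(C.image U.mkQ) = #C := by
    intro C t hC
    refine card_image_of_injOn fun x hx y hy hxy => ?_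
    have := hinj (hC x hx) (hC y hy) (by rw [map_add, map_add, hxy])
    simpa using this
  have hcA : #(A.image U.mkQ) = #A := by
    obtain ⟨s, hs⟩ := hS
    exact himage s fun a ha => add_mem_add ha hs
  have hcS : #(S.image U.mkQ) = #S := by
    obtain ⟨a, ha⟩ := hA
    exact himage a fun s hs => by rw [add_comm]; exact add_mem_add ha hs
  have hcB : #(B.image U.mkQ) = #B := card_image_of_injOn hinj
  -- The quotient has at most p K^15 |S| elements; the sixteenth K pays for |S| ≤ |A + S| ≤ K |A|.
  set α : ℝ := 1 / (p * K ^ 16) with hαdef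
  have hK16 : 1 ≤ K ^ 16 := one_le_pow₀ hK
  have hα : 0 < α := by positivity
  have hα2 : α ≤ 1 / 2 := by
    rw [hαdef]
    apply one_div_le_one_div_of_le (by norm_num)
    nlinarith
  have hQS : (Fintype.card (G ⧸ U) : ℝ) ≤ p * K ^ 15 * #S := by
    calc _ ≤ _ := hQ
      _ ≤ p * (K ^ 15 * #S) := by gcongr
      _ = _ := by ring
  have hdenseS : α * Fintype.card (G ⧸ U) ≤ #(S.image U.mkQ) := by
    rw [hcS, hαdef, one_div_mul_eq_div, div_le_iff₀ (by positivity)]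
    have : K ^ 15 ≤ K ^ 16 := pow_le_pow_right₀ hK (by norm_num)
    calc _ ≤ _ := hQS
      _ ≤ p * K ^ 16 * #S := by gcongr
      _ = _ := by ring
  have hdenseA : α * Fintype.card (G ⧸ U) ≤ #(A.image U.mkQ) := by
    rw [hcA, hαdef, one_div_mul_eq_div, div_le_iff₀ (by positivity)]
    calc _ ≤ _ := hQS
      _ ≤ p * K ^ 15 * (K * #A) := by gcongr; exact hSle.trans hKA
      _ = _ := by ring
  obtain ⟨V', hV', hdim⟩ := exists_submodule_subset_of_dense (p := p) hα hα2 hdenseA hdenseS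
  have himg : A.image U.mkQ + S.image U.mkQ - (A.image U.mkQ + S.image U.mkQ) =
      (B - B).image U.mkQ := by
    rw [hB, ← image_add]
    exact (image_image₂_distrib (map_sub U.mkQ)).symm
  obtain ⟨V, hV, hVdim⟩ := exists_submodule_lift (B := B) (V' := V') hU (by
    intro v hv
    have := hV' hv
    rw [himg] at this
    obtain ⟨d, hd, h⟩ := mem_image.1 (mem_coe.1 this)
    exact ⟨d, hd, h⟩)
  have hD0eq : A - A + (S - S) = B - B := (add_sub_add_comm A S A S).symm
  refine ⟨V, by rwa [hD0eq], ?_, ?_⟩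
  · have h1 : (#B : ℝ) ≤ (p : ℝ) ^ (Module.finrank (ZMod p) (G ⧸ U)) := by
      rw [← hcB]
      have h2 := Module.card_eq_pow_finrank (K := ZMod p) (V := G ⧸ U)
      rw [ZMod.card] at h2
      have h3 := card_le_univ (B.image U.mkQ)
      rw [h2] at h3
      exact_mod_cast h3
    have h2 : logb p #B ≤ Module.finrank (ZMod p) (G ⧸ U) := by
      rw [logb_le_iff_le_rpow (by linarith) hAS, rpow_natCast]
      exact h1
    have h3 : log (1 / α) = log p + 16 * log K := by
      rw [hαdef, one_div_one_div, log_mul (by positivity) (by positivity), log_pow]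
      norm_num
    rw [h3, ← hVdim] at hdim
    exact h2.trans hdim
  · have h1 : Nat.card V ≤ #D := by
      have h2 : (V : Set G) ⊆ (D : Set G) := hV.trans (coe_subset.2 hBD)
      have h3 := Set.ncard_le_ncard h2
      rw [Set.ncard_coe_finset] at h3
      exact h3
    calc (Nat.card V : ℝ) ≤ #D := by exact_mod_cast h1
      _ ≤ _ := hDcard
      _ ≤ _ := by gcongr

end Model

/-! ### The main theorem. -/

theorem mainTheorem8 (q p : ℕ) [Fact p.Prime] :
    ∃ C : ℝ, 0 < C ∧
      ∀ (F : Type*) [Field F] [Fintype F] [DecidableEq F] [Algebra (ZMod p) F],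
        Fintype.card F = q →
      ∀ (n : ℕ) (A S : Finset (Fin n → F)) (K : ℝ),
        A.Nonempty → S.Nonempty →
        ((A + S).card : ℝ) ≤ K * min (A.card : ℝ) (S.card : ℝ) →
        ∃ V : Submodule (ZMod p) (Fin n → F),
          (V : Set (Fin n → F)) ⊆ (((A - A) + (S - S) : Finset (Fin n → F)) : Set (Fin n → F)) ∧
          |Real.logb p ((A + S).card : ℝ) - (Module.finrank (ZMod p) V : ℝ)|
            ≤ C * Real.log K ^ 4 ∧
          Real.exp (-(C * Real.log K ^ 4)) * ((A + S).card : ℝ) ≤ (Nat.card V : ℝ) := by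
  have hp2 : (2 : ℝ) ≤ p := by exact_mod_cast (Fact.out : p.Prime).two_le
  have hlogp : 0.69 < log p := by
    have := log_le_log (by norm_num) hp2
    linarith [log_two_gt_d9]
  -- For K ≥ 3/2, log K ≥ 1/3 gives log p ≤ 3 log p log K, whence the factor 3. The extra 1 + log p
  -- in the final constant converts base-p to natural logarithms.
  set C₁ : ℝ := 10 ^ 7 * (3 * log p + 16) ^ 4 with hC₁
  have hC₁1 : 10 ^ 7 ≤ C₁ := by
    have : (1 : ℝ) ≤ (3 * log p + 16) ^ 4 := one_le_pow₀ (by linarith)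
    rw [hC₁]; linarith
  refine ⟨C₁ * (1 + log p), by positivity, ?_⟩
  intro F _ _ _ _ _ n A S K hA hS h
  have hA' : (0 : ℝ) < #A := by exact_mod_cast hA.card_pos
  have hS' : (0 : ℝ) < #S := by exact_mod_cast hS.card_pos
  have hAS : (0 : ℝ) < #(A + S) := by exact_mod_cast (hA.add hS).card_pos
  have hK0 : 0 < K := by
    have : 0 < K * min (#A : ℝ) #S := hAS.trans_le h
    exact (pos_iff_pos_of_mul_pos this).2 (lt_min hA' hS')
  have hKA : (#(A + S) : ℝ) ≤ K * #A := h.trans (by gcongr; exact min_le_left _ _)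
  have hKS : (#(A + S) : ℝ) ≤ K * #S := h.trans (by gcongr; exact min_le_right _ _)
  have hcardV : ∀ V : Submodule (ZMod p) (Fin n → F),
      (Nat.card V : ℝ) = (p : ℝ) ^ Module.finrank (ZMod p) V := by
    intro V
    have := Module.natCard_eq_pow_finrank (K := ZMod p) (V := V)
    rw [Nat.card_zmod] at this
    exact_mod_cast this
  have hlogV : ∀ V : Submodule (ZMod p) (Fin n → F),
      log (Nat.card V) = Module.finrank (ZMod p) V * log p := by
    intro V; rw [hcardV, log_pow]
  by_cases hK : K < 3 / 2
  · have h1 : 2 * #(A + S) < 3 * #A := by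
      have : (2 * #(A + S) : ℝ) < 3 * #A := by nlinarith
      exact_mod_cast this
    have h2 : 2 * #(A + S) < 3 * #S := by
      have : (2 * #(A + S) : ℝ) < 3 * #S := by nlinarith
      exact_mod_cast this
    obtain ⟨H, hH, hHcard⟩ := exists_addSubgroup_of_card_add_lt hA hS h1 h2
    set V := AddSubgroup.toZModSubmodule p H
    have hV : Nat.card V = #(A + S) := hHcard
    have hpos : 0 ≤ C₁ * (1 + log p) * log K ^ 4 := by
      have : 0 ≤ log K ^ 4 := by positivity
      positivity
    refine ⟨V, hH, ?_, ?_⟩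
    · rw [← hV, logb, hlogV, mul_div_cancel_right₀ _ (by linarith), sub_self, abs_zero]
      exact hpos
    · rw [hV]
      have : exp (-(C₁ * (1 + log p) * log K ^ 4)) ≤ 1 := exp_le_one_iff.2 (by linarith)
      nlinarith
  · push Not at hK
    obtain ⟨V, hV, hlow, hup⟩ := exists_submodule_subset_of_small_sumset (p := p) hA hS
      (by linarith) hKA hKS
    set l := log K with hl
    have hl3 : 1 / 3 ≤ l := by
      have h1 := one_sub_inv_le_log_of_pos (show (0 : ℝ) < 3 / 2 by norm_num)
      have h2 := log_le_log (by norm_num) hK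
      norm_num at h1
      linarith
    have hl4 : l ≤ 27 * l ^ 4 := by
      have : (1 / 3 : ℝ) ^ 3 ≤ l ^ 3 := by gcongr
      nlinarith
    have hl40 : 0 ≤ l ^ 4 := by positivity
    have hb : 10 ^ 7 * (log p + 16 * l) ^ 4 ≤ C₁ * l ^ 4 := by
      rw [hC₁, mul_assoc, ← mul_pow]
      gcongr
      nlinarith
    have hd1 : logb p #(A + S) - Module.finrank (ZMod p) V ≤ C₁ * l ^ 4 := by linarith
    have hd2 : (Module.finrank (ZMod p) V : ℝ) - logb p #(A + S) ≤ C₁ * l ^ 4 := by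
      have h1 := log_le_log (by rw [hcardV]; positivity) hup
      rw [hlogV, log_mul (by positivity) hAS.ne', log_pow] at h1
      have h2 : (Module.finrank (ZMod p) V : ℝ) - logb p #(A + S) ≤ 15 * l / log p := by
        rw [le_div_iff₀ (by linarith), sub_mul, logb, div_mul_cancel₀ _ (by linarith)]
        push_cast at h1
        linarith
      refine h2.trans ?_
      rw [div_le_iff₀ (by linarith)]
      nlinarith [mul_nonneg (sub_nonneg.2 hC₁1) hl40]
    have hCl : C₁ * l ^ 4 ≤ C₁ * (1 + log p) * l ^ 4 := by
      gcongr
      nlinarith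
    refine ⟨V, hV, abs_le.2 ⟨by linarith, by linarith⟩, ?_⟩
    have h1 : log #(A + S) ≤ Module.finrank (ZMod p) V * log p + C₁ * (1 + log p) * l ^ 4 := by
      have h2 : log #(A + S) = logb p #(A + S) * log p := by
        rw [logb, div_mul_cancel₀ _ (by linarith)]
      rw [h2]
      have h3 : logb p #(A + S) * log p ≤ (Module.finrank (ZMod p) V + C₁ * l ^ 4) * log p := by
        gcongr
        linarith
      have h4 : 0 ≤ C₁ * l ^ 4 := by positivity
      nlinarith
    have hVpos : (0 : ℝ) < Nat.card V := by rw [hcardV]; positivity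
    rw [← exp_log hAS, ← exp_add, ← le_log_iff_exp_le hVpos, hlogV]
    linarith
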